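/- Let $\mathcal A=\ell^\infty(\mathbb N,\ell^\infty_4)$ be the C*-algebra which is the $\ell^\infty$-direct sum of countably many copies of $\ell^\infty_4=\mathbb C^4$, regarded as an operator system with unit $e=1$ and positive cones $M_n(\mathcal A)^+$. A subspace $J\subseteq\mathcal A$ is called a kernel if it is the intersection of the kernels of a non-empty family of states of $\mathcal A$ (equivalently, the kernel of a unital completely positive map into a non-zero operator system). For a kernel $J$, the operator system quotient of $\mathcal A$ by $J$ is the vector space $\mathcal A/J$ with unit $e+J$ and the matrix cones $$C_n=\{(x_{ij}+J)\in M_n(\mathcal A/J):\ \forall \varepsilon>0\ \exists k_{ij}\in J \text{ with } \varepsilon\, 1\otimes I_n+(x_{ij}+k_{ij})\in M_n(\mathcal A)^+\};$$ its norm is $$\|x+J\|_{osy}=\inf\Big\{t\ge 0:\ \begin{pmatrix} t(e+J) & x+J\\ x^*+J & t(e+J)\end{pmatrix}\in C_2\Big\},$$ which is the norm obtained from any unital complete order embedding of $\mathcal A/J$ into some $B(H)$. The operator space quotient norm is $\|x+J\|_{osp}=\inf_{y\in J}\|x+y\|$. Let $C^*_u(\mathcal A)$ be the universal C*-algebra of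 the operator system $\mathcal A$, i.e. the C*-algebra generated by a copy of $\mathcal A$ to which every unital completely positive map from $\mathcal A$ into a C*-algebra extends as a $*$-homomorphism, and let $\langle J\rangle$ be the closed two-sided ideal of $C^*_u(\mathcal A)$ generated by $J$. Then there exists a kernel $J\subseteq\mathcal A$ such that 1. $\mathcal A/J$ is not complete in the norm $\|\cdot\|_{osy}$; 2. the norms $\|\cdot\|_{osy}$ and $\|\cdot\|_{osp}$ on $\mathcal A/J$ are not equivalent; 3. the image of $\mathcal A$ under the map $q:\mathcal A\to C^*_u(\mathcal A)/\langle J\rangle$, $q(x)=x+\langle J\rangle$, is not closed. -/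

import Mathlib

open scoped ENNReal Matrix

noncomputable section

universe u

/-! ### Abstract operator systems -/

section Basic

variable {V : Type*} [AddCommGroup V] [Module ℂ V]

/-- The matrix `X^* M X` over `V`, where `X` is an `n × m` scalar matrix and `M ∈ M_n(V)`. -/
def scalarConj {n m : ℕ} (X : Matrix (Fin n) (Fin m) ℂ) (M : Matrix (Fin n) (Fin n) V) :
    Matrix (Fin m) (Fin m) V :=
  Matrix.of fun i j => ∑ k, ∑ l, (star (X k i) * X l j) • M k l

/-- The scalar multiple `r • e_n` of the diagonal matrix `e_n = diag(e, …, e)`. -/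
def diagUnit (e : V) (n : ℕ) (r : ℝ) : Matrix (Fin n) (Fin n) V :=
  Matrix.diagonal fun _ => (r : ℂ) • e

theorem scalarConj_add {n m : ℕ} (X : Matrix (Fin n) (Fin m) ℂ)
    (K L : Matrix (Fin n) (Fin n) V) :
    scalarConj X (K + L) = scalarConj X K + scalarConj X L := by
  ext i j
  simp [scalarConj, Finset.sum_add_distrib]

theorem scalarConj_smul {n m : ℕ} (X : Matrix (Fin n) (Fin m) ℂ) (c : ℂ)
    (K : Matrix (Fin n) (Fin n) V) :
    scalarConj X (c • K) = c • scalarConj X K := by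
  ext i j
  simp only [scalarConj, Matrix.of_apply, Matrix.smul_apply, Finset.smul_sum]
  exact Finset.sum_congr rfl fun k _ => Finset.sum_congr rfl fun l _ => smul_comm _ _ _

end Basic

/-- An (abstract, Choi–Effros) operator system on a complex `*`-vector space `V`: a family of
proper, compatible cones `C_n ⊆ M_n(V)_h` together with an Archimedean matrix order unit.
(The degenerate level `n = 0` is included for convenience: the axioms force `C_0 = {0} = M_0(V)`.) -/
class OperatorSystem (V : Type*) [AddCommGroup V] [Module ℂ V] [StarAddMonoid V]
    [StarModule ℂ V] where
  /-- the unit `e` -/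
  unit : V
  /-- the cone `C_n` of positive elements of `M_n(V)` -/
  cone : ∀ n : ℕ, Set (Matrix (Fin n) (Fin n) V)
  star_unit : star unit = unit
  conjTranspose_eq : ∀ {n : ℕ} {M : Matrix (Fin n) (Fin n) V}, M ∈ cone n → Mᴴ = M
  zero_mem : ∀ n : ℕ, (0 : Matrix (Fin n) (Fin n) V) ∈ cone n
  add_mem : ∀ {n : ℕ} {M N : Matrix (Fin n) (Fin n) V}, M ∈ cone n → N ∈ cone n → M + N ∈ cone n
  smul_mem : ∀ {n : ℕ} {M : Matrix (Fin n) (Fin n) V} {r : ℝ}, 0 ≤ r → M ∈ cone n →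
    (r : ℂ) • M ∈ cone n
  eq_zero : ∀ {n : ℕ} {M : Matrix (Fin n) (Fin n) V}, M ∈ cone n → -M ∈ cone n → M = 0
  scalarConj_mem : ∀ {n m : ℕ} (X : Matrix (Fin n) (Fin m) ℂ) {M : Matrix (Fin n) (Fin n) V},
    M ∈ cone n → scalarConj X M ∈ cone m
  exists_le_unit : ∀ {n : ℕ} (M : Matrix (Fin n) (Fin n) V), Mᴴ = M →
    ∃ r : ℝ, 0 < r ∧ diagUnit unit n r - M ∈ cone n
  archimedean : ∀ {n : ℕ} (M : Matrix (Fin n) (Fin n) V),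
    (∀ r : ℝ, 0 < r → diagUnit unit n r + M ∈ cone n) → M ∈ cone n

namespace OperatorSystem

section General

variable {V : Type*} [AddCommGroup V] [Module ℂ V] [StarAddMonoid V] [StarModule ℂ V]
  [OperatorSystem V]
variable {W : Type*} [AddCommGroup W] [Module ℂ W] [StarAddMonoid W] [StarModule ℂ W]
  [OperatorSystem W]

/-- Unital completely positive maps. -/
structure IsUCP (φ : V →ₗ[ℂ] W) : Prop where
  map_unit : φ unit = unit
  map_cone : ∀ (n : ℕ) (M : Matrix (Fin n) (Fin n) V), M ∈ cone n → M.map φ ∈ cone n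

/-- Unital complete order embeddings, that is, complete order isomorphisms onto the range that
respect the units. -/
structure IsUnitalCompleteOrderEmbedding (φ : V →ₗ[ℂ] W) : Prop where
  injective : Function.Injective φ
  map_unit : φ unit = unit
  map_cone_iff : ∀ (n : ℕ) (M : Matrix (Fin n) (Fin n) V), M.map φ ∈ cone n ↔ M ∈ cone n

/-- The matrix `[[t e, x], [x^*, t e]]`. -/
def normMatrix (t : ℝ) (x : V) : Matrix (Fin 2) (Fin 2) V :=
  !![(t : ℂ) • unit, x; star x, (t : ℂ) • unit]

/-- The norm of an operator system: the infimum of all `t ≥ 0` with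
`[[t e, x], [x^*, t e]] ∈ C_2`. -/
def norm (x : V) : ℝ := sInf {t : ℝ | 0 ≤ t ∧ normMatrix t x ∈ cone 2}

/-- States of an operator system. -/
structure IsState (f : V →ₗ[ℂ] ℂ) : Prop where
  map_unit : f unit = 1
  nonneg : ∀ v : V, (Matrix.of fun _ _ : Fin 1 => v) ∈ cone 1 → 0 ≤ (f v).re ∧ (f v).im = 0

/-- Kernels: the intersections of the kernels of the members of a non-empty family of states. -/
def IsKernel (J : Submodule ℂ V) : Prop :=
  ∃ F : Set (V →ₗ[ℂ] ℂ), F.Nonempty ∧ (∀ f ∈ F, IsState f) ∧ J = ⨅ f ∈ F, LinearMap.ker f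

/-! ### Facts needed for the operator system norm -/

theorem diagUnit_mem (n : ℕ) {r : ℝ} (hr : 0 ≤ r) : diagUnit (unit : V) n r ∈ cone n := by
  obtain ⟨s, hs, h⟩ := exists_le_unit (0 : Matrix (Fin n) (Fin n) V) (by simp)
  have := smul_mem (r := r / s) (by positivity) h
  convert this using 1
  ext i j
  by_cases hij : i = j
  · subst hij
    simp [-Complex.coe_smul, diagUnit, smul_smul, hs.ne']
  · simp [diagUnit, hij]

theorem normMatrix_mono {s t : ℝ} (h : s ≤ t) {x : V} (hs : normMatrix s x ∈ cone 2) :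
    normMatrix t x ∈ cone 2 := by
  have := add_mem hs (diagUnit_mem (V := V) 2 (sub_nonneg.2 h))
  convert this using 1
  ext i j
  fin_cases i <;> fin_cases j <;> simp [-Complex.coe_smul, normMatrix, diagUnit, ← add_smul]

theorem exists_normMatrix_mem (x : V) : ∃ t : ℝ, 0 ≤ t ∧ normMatrix t x ∈ cone 2 := by
  obtain ⟨r, hr, h⟩ := exists_le_unit (V := V) (n := 2) (!![0, -x; -star x, 0]) (by
    ext i j
    fin_cases i <;> fin_cases j <;> simp [Matrix.conjTranspose_apply])
  refine ⟨r, hr.le, ?_⟩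
  convert h using 1
  ext i j
  fin_cases i <;> fin_cases j <;> simp [-Complex.coe_smul, normMatrix, diagUnit]

theorem normMatrix_norm_mem (x : V) : normMatrix (norm x) x ∈ cone 2 := by
  refine archimedean _ fun r hr => ?_
  obtain ⟨t, ⟨ht0, ht⟩, htr⟩ := Real.lt_sInf_add_pos
    (s := {t : ℝ | 0 ≤ t ∧ normMatrix t x ∈ cone 2}) (exists_normMatrix_mem x) hr
  have := normMatrix_mono htr.le ht
  convert this using 1
  ext i j
  fin_cases i <;> fin_cases j <;> simp [-Complex.coe_smul, normMatrix, diagUnit, ← add_smul, norm, add_comm]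

theorem norm_nonneg (x : V) : 0 ≤ norm x := Real.sInf_nonneg fun _ h => h.1

theorem norm_le_iff {x : V} {t : ℝ} (ht : 0 ≤ t) : norm x ≤ t ↔ normMatrix t x ∈ cone 2 :=
  ⟨fun h => normMatrix_mono h (normMatrix_norm_mem x),
    fun h => csInf_le ⟨0, fun _ h => h.1⟩ ⟨ht, h⟩⟩

theorem norm_add_le (x y : V) : norm (x + y) ≤ norm x + norm y := by
  rw [norm_le_iff (add_nonneg (norm_nonneg x) (norm_nonneg y))]
  convert add_mem (normMatrix_norm_mem x) (normMatrix_norm_mem y) using 1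
  ext i j
  fin_cases i <;> fin_cases j <;> simp [-Complex.coe_smul, normMatrix, ← add_smul]

theorem eq_zero_of_norm_eq_zero {x : V} (h : norm x = 0) : x = 0 := by
  have h1 := normMatrix_norm_mem x
  have h2 := scalarConj_mem (!![1, 0; 0, -1] : Matrix (Fin 2) (Fin 2) ℂ) h1
  have h3 := eq_zero h1 (by
    convert h2 using 1
    ext i j
    fin_cases i <;> fin_cases j <;> simp [-Complex.coe_smul, normMatrix, h, scalarConj])
  simpa [normMatrix] using congrFun (congrFun h3 0) 1

theorem norm_zero : norm (0 : V) = 0 := by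
  refine le_antisymm ((norm_le_iff le_rfl).2 ?_) (norm_nonneg _)
  convert zero_mem (V := V) 2 using 1
  ext i j
  fin_cases i <;> fin_cases j <;> simp [-Complex.coe_smul, normMatrix]

theorem norm_smul_le (c : ℂ) (x : V) : norm (c • x) ≤ ‖c‖ * norm x := by
  rcases eq_or_ne c 0 with rfl | hc
  · simp [norm_zero]
  have hc' : (‖c‖ : ℂ) ≠ 0 := by simpa using hc
  rw [norm_le_iff (mul_nonneg (_root_.norm_nonneg c) (norm_nonneg x))]
  have h1 := smul_mem (r := ‖c‖) (_root_.norm_nonneg c) (scalarConj_mem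
    (!![1, 0; 0, c / ‖c‖] : Matrix (Fin 2) (Fin 2) ℂ) (normMatrix_norm_mem x))
  have h2 : (starRingEnd ℂ) c * c = ‖c‖ * ‖c‖ := by
    rw [Complex.conj_mul']; ring
  convert h1 using 1
  ext i j
  fin_cases i <;> fin_cases j
  · simp [-Complex.coe_smul, normMatrix, scalarConj, smul_smul]
  · simp [-Complex.coe_smul, normMatrix, scalarConj, smul_smul, mul_div_cancel₀ _ hc']
  · simp [-Complex.coe_smul, normMatrix, scalarConj, smul_smul, mul_div_cancel₀ _ hc']
  · simp [-Complex.coe_smul, normMatrix, scalarConj, smul_smul]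
    congr 1
    field_simp
    linear_combination (-(norm x : ℂ)) * h2

/-! ### Facts needed for the quotient operator system -/

theorem IsState.im_eq_zero {f : V →ₗ[ℂ] ℂ} (hf : IsState f) {v : V} (hv : star v = v) :
    (f v).im = 0 := by
  obtain ⟨r, hr, h⟩ := exists_le_unit (V := V) (Matrix.of fun _ _ : Fin 1 => v)
    (by ext i j; simp [hv])
  have h1 : (diagUnit (unit : V) 1 r - Matrix.of fun _ _ : Fin 1 => v) =
      Matrix.of fun _ _ : Fin 1 => (r : ℂ) • (unit : V) - v := by
    ext i j
    simp [diagUnit, Subsingleton.elim i j]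
  rw [h1] at h
  have h2 := (hf.nonneg _ h).2
  rw [map_sub, map_smul, hf.map_unit] at h2
  simpa using h2

theorem IsState.map_star {f : V →ₗ[ℂ] ℂ} (hf : IsState f) (x : V) :
    f (star x) = star (f x) := by
  have h1 := hf.im_eq_zero (v := x + star x) (by simp [add_comm])
  have h2 := hf.im_eq_zero (v := Complex.I • (x - star x)) (by
    rw [star_smul, star_sub, star_star, Complex.star_def, Complex.conj_I, neg_smul, ← smul_neg,
      neg_sub])
  simp only [map_add, map_smul, map_sub] at h1 h2
  simp at h1 h2
  apply Complex.ext
  · simp; linarith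
  · simp; linarith

theorem IsState.form_nonneg {f : V →ₗ[ℂ] ℂ} (hf : IsState f) {n : ℕ}
    {M : Matrix (Fin n) (Fin n) V} (hM : M ∈ cone n) (v : Fin n → ℂ) :
    0 ≤ (∑ k, ∑ l, star (v k) * v l * f (M k l)).re ∧
      (∑ k, ∑ l, star (v k) * v l * f (M k l)).im = 0 := by
  have h := scalarConj_mem (Matrix.of fun k (_ : Fin 1) => v k) hM
  have h1 := hf.nonneg (∑ k, ∑ l, (star (v k) * v l) • M k l) h
  simpa only [map_sum, map_smul, smul_eq_mul] using h1

theorem matrix_eq_zero_of_form {n : ℕ} (G : Matrix (Fin n) (Fin n) ℂ)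
    (h : ∀ v : Fin n → ℂ, ∑ k, ∑ l, star (v k) * v l * G k l = 0) : G = 0 := by
  have h1 : Matrix.toEuclideanLin G = 0 := by
    rw [← inner_map_self_eq_zero]
    intro x
    rw [← inner_conj_symm, map_eq_zero, PiLp.inner_apply, ← h x]
    refine Finset.sum_congr rfl fun k _ => ?_
    simp [Matrix.toEuclideanLin, Matrix.mulVec, dotProduct, Finset.sum_mul]
    refine Finset.sum_congr rfl fun l _ => by ring
  simpa using h1

theorem IsState.form_nonneg_of_approx {f : V →ₗ[ℂ] ℂ} (hf : IsState f) {n : ℕ}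
    {M : Matrix (Fin n) (Fin n) V} (hM : ∀ ε : ℝ, 0 < ε → ∃ K : Matrix (Fin n) (Fin n) V,
      (∀ i j, f (K i j) = f (M i j)) ∧ diagUnit unit n ε + K ∈ cone n) (v : Fin n → ℂ) :
    0 ≤ (∑ k, ∑ l, star (v k) * v l * f (M k l)).re ∧
      (∑ k, ∑ l, star (v k) * v l * f (M k l)).im = 0 := by
  have key : ∀ ε : ℝ, 0 < ε →
      0 ≤ ε * (∑ k, Complex.normSq (v k)) + (∑ k, ∑ l, star (v k) * v l * f (M k l)).re ∧
      (∑ k, ∑ l, star (v k) * v l * f (M k l)).im = 0 := by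
    intro ε hε
    obtain ⟨K, hK, h⟩ := hM ε hε
    have h1 := hf.form_nonneg h v
    have h2 : ∑ k, ∑ l, star (v k) * v l * f ((diagUnit unit n ε + K : Matrix (Fin n) (Fin n) V) k l) =
        ((ε * ∑ k, Complex.normSq (v k) : ℝ) : ℂ) +
          ∑ k, ∑ l, star (v k) * v l * f (M k l) := by
      simp only [Matrix.add_apply, map_add, mul_add, Finset.sum_add_distrib, hK]
      congr 1
      rw [Complex.ofReal_mul, Complex.ofReal_sum, Finset.mul_sum]
      refine Finset.sum_congr rfl fun k _ => ?_
      rw [Finset.sum_eq_single k (fun l _ hl => by simp [diagUnit, hl.symm]) (by simp)]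
      simp [-Complex.coe_smul, diagUnit, hf.map_unit, Complex.normSq_eq_conj_mul_self, mul_comm]
    rw [h2] at h1
    simpa using h1
  refine ⟨le_of_forall_pos_le_add fun δ hδ => ?_, (key 1 one_pos).2⟩
  have hs : 0 ≤ ∑ k, Complex.normSq (v k) := Finset.sum_nonneg fun k _ => Complex.normSq_nonneg _
  have := (key (δ / (∑ k, Complex.normSq (v k) + 1)) (by positivity)).1
  have h3 : δ / (∑ k, Complex.normSq (v k) + 1) * (∑ k, Complex.normSq (v k)) ≤ δ := by
    rw [div_mul_eq_mul_div, div_le_iff₀ (by positivity)]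
    nlinarith
  linarith

theorem IsKernel.star_mem {J : Submodule ℂ V} (hJ : IsKernel J) {x : V} (hx : x ∈ J) :
    star x ∈ J := by
  obtain ⟨F, -, hF, rfl⟩ := hJ
  simp only [Submodule.mem_iInf, LinearMap.mem_ker] at hx ⊢
  intro f hf
  rw [(hF f hf).map_star, hx f hf, star_zero]

theorem IsKernel.mem_of_approx {J : Submodule ℂ V} (hJ : IsKernel J) {n : ℕ}
    {M : Matrix (Fin n) (Fin n) V}
    (h₁ : ∀ ε : ℝ, 0 < ε → ∃ K : Matrix (Fin n) (Fin n) V,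
      (∀ i j, K i j - M i j ∈ J) ∧ diagUnit unit n ε + K ∈ cone n)
    (h₂ : ∀ ε : ℝ, 0 < ε → ∃ K : Matrix (Fin n) (Fin n) V,
      (∀ i j, K i j - (-M) i j ∈ J) ∧ diagUnit unit n ε + K ∈ cone n) (i j : Fin n) :
    M i j ∈ J := by
  obtain ⟨F, -, hF, rfl⟩ := hJ
  simp only [Submodule.mem_iInf, LinearMap.mem_ker, map_sub, sub_eq_zero] at h₁ h₂ ⊢
  intro f hf
  have h := matrix_eq_zero_of_form (M.map f) fun v => by
    have h3 := (hF f hf).form_nonneg_of_approx (M := M) (fun ε hε => by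
      obtain ⟨K, hK, hK'⟩ := h₁ ε hε
      exact ⟨K, fun i j => hK i j f hf, hK'⟩) v
    have h4 := (hF f hf).form_nonneg_of_approx (M := -M) (fun ε hε => by
      obtain ⟨K, hK, hK'⟩ := h₂ ε hε
      exact ⟨K, fun i j => hK i j f hf, hK'⟩) v
    have h5 : ∑ k, ∑ l, star (v k) * v l * f ((-M) k l) =
        -∑ k, ∑ l, star (v k) * v l * f (M k l) := by
      simp
    rw [h5, Complex.neg_re] at h4
    exact Complex.ext (le_antisymm (neg_nonneg.1 h4.1) h3.1) h3.2
  exact congrFun (congrFun h i) j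

end General

/-! ### Unital C*-algebras as operator systems -/

section CStar

variable {A : Type*} [CStarAlgebra A]

/-- The cone of positive elements `N^* N` of the C*-algebra `M_n(A)`. -/
def cstarCone (A : Type*) [CStarAlgebra A] (n : ℕ) : Set (Matrix (Fin n) (Fin n) A) :=
  {M | ∃ N : Matrix (Fin n) (Fin n) A, M = Nᴴ * N}

theorem nonneg_iff_exists_star_mul {B : Type*} [CStarAlgebra B] [PartialOrder B]
    [StarOrderedRing B] (a : B) : 0 ≤ a ↔ ∃ b : B, a = star b * b :=
  CStarAlgebra.nonneg_iff_eq_star_mul_self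

theorem mem_cstarCone_iff [PartialOrder A] [StarOrderedRing A] {n : ℕ}
    {M : Matrix (Fin n) (Fin n) A} : M ∈ cstarCone A n ↔ 0 ≤ CStarMatrix.ofMatrix M :=
  (nonneg_iff_exists_star_mul (CStarMatrix.ofMatrix M)).symm

theorem cstarCone_add {n : ℕ} {M N : Matrix (Fin n) (Fin n) A} (hM : M ∈ cstarCone A n)
    (hN : N ∈ cstarCone A n) : M + N ∈ cstarCone A n := by
  let := CStarAlgebra.spectralOrder A
  have := CStarAlgebra.spectralOrderedRing A
  rw [mem_cstarCone_iff] at *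
  exact add_nonneg hM hN

theorem rect_mem_cstarCone {k m : ℕ} (N : Matrix (Fin k) (Fin m) A) : Nᴴ * N ∈ cstarCone A m := by
  rcases m with _ | m
  · exact ⟨0, Subsingleton.elim _ _⟩
  let R : Fin k → Matrix (Fin (m + 1)) (Fin (m + 1)) A := fun i =>
    Matrix.of fun r b => if r = 0 then N i b else 0
  have h : Nᴴ * N = ∑ i, (R i)ᴴ * R i := by
    ext a b
    simp [Matrix.mul_apply, Matrix.sum_apply, R]
  rw [h]
  exact Finset.sum_induction _ (· ∈ cstarCone A (m + 1)) (fun _ _ => cstarCone_add)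
    ⟨0, by simp⟩ fun i _ => ⟨R i, rfl⟩

theorem cstarCone_scalarConj {n m : ℕ} (X : Matrix (Fin n) (Fin m) ℂ)
    {M : Matrix (Fin n) (Fin n) A} (hM : M ∈ cstarCone A n) : scalarConj X M ∈ cstarCone A m := by
  obtain ⟨N, rfl⟩ := hM
  convert rect_mem_cstarCone (N * X.map (algebraMap ℂ A)) using 1
  have h : X.map (algebraMap ℂ A) = Matrix.of fun i j => X i j • (1 : A) := by
    ext i j
    simp [Algebra.algebraMap_eq_smul_one]
  rw [Matrix.conjTranspose_mul, Matrix.mul_assoc, ← Matrix.mul_assoc Nᴴ, h]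
  generalize Nᴴ * N = M
  ext i j
  simp only [scalarConj, Matrix.of_apply, Matrix.mul_apply, Matrix.conjTranspose_apply,
    star_smul, star_one, smul_mul_assoc, one_mul, mul_smul_comm, mul_one, Finset.smul_sum,
    smul_smul]

theorem ofMatrix_diagUnit (n : ℕ) (r : ℝ) : CStarMatrix.ofMatrix (diagUnit (1 : A) n r) =
    r • (1 : CStarMatrix (Fin n) (Fin n) A) := by
  change _ = (r : ℂ) • (1 : CStarMatrix (Fin n) (Fin n) A)
  ext i j
  rw [CStarMatrix.smul_apply, CStarMatrix.one_apply]
  by_cases hij : i = j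
  · subst hij
    simp [diagUnit]
  · simp [diagUnit, hij]

theorem cstarCone_exists_le {n : ℕ} (M : Matrix (Fin n) (Fin n) A) (hM : Mᴴ = M) :
    ∃ r : ℝ, 0 < r ∧ diagUnit (1 : A) n r - M ∈ cstarCone A n := by
  let := CStarAlgebra.spectralOrder A
  have := CStarAlgebra.spectralOrderedRing A
  refine ⟨‖CStarMatrix.ofMatrix M‖ + 1, by positivity, ?_⟩
  have h := IsSelfAdjoint.le_algebraMap_norm_self (a := CStarMatrix.ofMatrix M) hM
  have h1 : (0 : CStarMatrix (Fin n) (Fin n) A) ≤ 1 := zero_le_one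
  rw [mem_cstarCone_iff]
  change 0 ≤ CStarMatrix.ofMatrix (diagUnit (1 : A) n _) - CStarMatrix.ofMatrix M
  rw [ofMatrix_diagUnit, add_smul, one_smul, ← Algebra.algebraMap_eq_smul_one, sub_nonneg]
  exact h.trans (le_add_of_nonneg_right h1)

theorem cstarCone_archimedean {n : ℕ} (M : Matrix (Fin n) (Fin n) A)
    (hM : ∀ r : ℝ, 0 < r → diagUnit (1 : A) n r + M ∈ cstarCone A n) : M ∈ cstarCone A n := by
  let := CStarAlgebra.spectralOrder A
  have := CStarAlgebra.spectralOrderedRing A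
  simp only [mem_cstarCone_iff] at *
  have h : Filter.Tendsto (fun r : ℝ => r • (1 : CStarMatrix (Fin n) (Fin n) A) +
      CStarMatrix.ofMatrix M) (nhdsWithin 0 (Set.Ioi 0)) (nhds (CStarMatrix.ofMatrix M)) := by
    have : Continuous fun r : ℝ => r • (1 : CStarMatrix (Fin n) (Fin n) A) +
      CStarMatrix.ofMatrix M := by fun_prop
    have h2 := this.tendsto 0
    simp only [zero_smul, zero_add] at h2
    exact h2.mono_left nhdsWithin_le_nhds
  refine (CStarAlgebra.isClosed_nonneg (A := CStarMatrix (Fin n) (Fin n) A)).mem_of_tendsto h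
    (Filter.eventually_of_mem self_mem_nhdsWithin fun r hr => ?_)
  have h3 := hM r hr
  change 0 ≤ CStarMatrix.ofMatrix (diagUnit (1 : A) n r) + CStarMatrix.ofMatrix M at h3
  rwa [ofMatrix_diagUnit] at h3

/-- A unital C*-algebra `A` is an operator system with unit `1` and the C*-algebraic cones
`M_n(A)^+`. -/
instance ofCStarAlgebra (A : Type*) [CStarAlgebra A] : OperatorSystem A where
  unit := 1
  cone := cstarCone A
  star_unit := star_one A
  conjTranspose_eq := by
    rintro n _ ⟨N, rfl⟩
    simp
  zero_mem n := ⟨0, by simp⟩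
  add_mem := cstarCone_add
  smul_mem := by
    rintro n _ r hr ⟨N, rfl⟩
    refine ⟨(√r : ℂ) • N, ?_⟩
    rw [Matrix.conjTranspose_smul, Matrix.smul_mul, Matrix.mul_smul, smul_smul]
    congr 1
    rw [Complex.star_def, Complex.conj_ofReal, ← Complex.ofReal_mul, Real.mul_self_sqrt hr]
  eq_zero := by
    intro n M h1 h2
    let := CStarAlgebra.spectralOrder A
    have := CStarAlgebra.spectralOrderedRing A
    rw [mem_cstarCone_iff] at h1 h2
    have h3 : 0 ≤ -CStarMatrix.ofMatrix M := h2
    exact le_antisymm (a := CStarMatrix.ofMatrix M) (neg_nonneg.1 h3) h1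
  scalarConj_mem := cstarCone_scalarConj
  exists_le_unit := cstarCone_exists_le
  archimedean := cstarCone_archimedean

theorem unit_eq_one : (unit : A) = 1 := rfl

theorem normMatrix_mem_iff {t : ℝ} (ht : 0 ≤ t) (a : A) :
    normMatrix t a ∈ cone 2 ↔ ‖a‖ ≤ t := by
  let := CStarAlgebra.spectralOrder A
  have := CStarAlgebra.spectralOrderedRing A
  constructor
  · rintro ⟨N, hN⟩
    let x : WithCStarModule A (Fin 2 → A) := (WithCStarModule.equiv A _).symm fun i => star (N i 1)
    let y : WithCStarModule A (Fin 2 → A) := (WithCStarModule.equiv A _).symm fun i => star (N i 0)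
    have hxy : inner A x y = a := by
      have h := congrFun (congrFun hN 0) 1
      simpa [normMatrix, Matrix.mul_apply, WithCStarModule.pi_inner,
        WithCStarModule.inner_def, x, y] using h.symm
    have h1 : ‖(t : ℂ) • (1 : A)‖ ≤ t := by
      rcases subsingleton_or_nontrivial A with _ | _
      · rw [Subsingleton.elim ((t : ℂ) • (1 : A)) 0, _root_.norm_zero]
        exact ht
      · rw [norm_smul, CStarRing.norm_one, mul_one, Complex.norm_real, Real.norm_of_nonneg ht]
    have hx : ‖x‖ ≤ √t := by
      rw [WithCStarModule.pi_norm]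
      refine Real.sqrt_le_sqrt (le_trans (le_of_eq ?_) h1)
      have h := congrFun (congrFun hN 1) 1
      congr 1
      simpa [-Complex.coe_smul, normMatrix, Matrix.mul_apply, unit_eq_one,
        WithCStarModule.inner_def, x] using h.symm
    have hy : ‖y‖ ≤ √t := by
      rw [WithCStarModule.pi_norm]
      refine Real.sqrt_le_sqrt (le_trans (le_of_eq ?_) h1)
      have h := congrFun (congrFun hN 0) 0
      congr 1
      simpa [-Complex.coe_smul, normMatrix, Matrix.mul_apply, unit_eq_one,
        WithCStarModule.inner_def, y] using h.symm
    calc ‖a‖ = ‖inner A x y‖ := by rw [hxy]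
      _ ≤ ‖x‖ * ‖y‖ := CStarModule.norm_inner_le _
      _ ≤ √t * √t := by gcongr
      _ = t := Real.mul_self_sqrt ht
  · intro h
    rcases ht.eq_or_lt with rfl | ht
    · have ha : a = 0 := by simpa using h
      refine ⟨0, ?_⟩
      ext i j
      fin_cases i <;> fin_cases j <;> simp [normMatrix, ha]
    have h1 : 0 ≤ (t : ℂ) • (1 : A) - ((t⁻¹ : ℝ) : ℂ) • (star a * a) := by
      rw [sub_nonneg]
      have h2 : star a * a ≤ algebraMap ℝ A (t * t) := by
        refine (CStarAlgebra.star_mul_le_algebraMap_norm_sq (a := a)).trans ?_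
        refine algebraMap_mono A ?_
        nlinarith [_root_.norm_nonneg a]
      have h3 := smul_le_smul_of_nonneg_left h2 (inv_nonneg.2 ht.le)
      rw [Algebra.algebraMap_eq_smul_one, smul_smul, inv_mul_cancel_left₀ ht.ne'] at h3
      exact h3
    obtain ⟨c, hc⟩ := (nonneg_iff_exists_star_mul _).1 h1
    have hs : ((√t : ℝ) : ℂ) * ((√t : ℝ) : ℂ) = t := by
      rw [← Complex.ofReal_mul, Real.mul_self_sqrt ht.le]
    have hs0 : ((√t : ℝ) : ℂ) ≠ 0 := by
      simpa using (Real.sqrt_pos.2 ht).ne'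
    refine ⟨!![((√t : ℝ) : ℂ) • 1, (((√t)⁻¹ : ℝ) : ℂ) • a; 0, c], ?_⟩
    have hi : (((√t)⁻¹ : ℝ) : ℂ) * (((√t)⁻¹ : ℝ) : ℂ) = ((t⁻¹ : ℝ) : ℂ) := by
      rw [← Complex.ofReal_mul, ← mul_inv, Real.mul_self_sqrt ht.le]
    have hi2 : (((√t)⁻¹ : ℝ) : ℂ) * ((√t : ℝ) : ℂ) = 1 := by
      rw [Complex.ofReal_inv, inv_mul_cancel₀ hs0]
    have hi3 : ((√t : ℝ) : ℂ) * (((√t)⁻¹ : ℝ) : ℂ) = 1 := by rw [mul_comm, hi2]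
    ext i j
    fin_cases i <;> fin_cases j <;>
      simp only [normMatrix, Matrix.mul_apply, Fin.sum_univ_two, Matrix.conjTranspose_apply,
        Fin.zero_eta, Fin.mk_one, unit_eq_one, Matrix.of_apply, Matrix.cons_val', Matrix.cons_val_zero,
        Matrix.cons_val_one, Matrix.cons_val_fin_one, star_smul, star_one, star_zero, zero_mul,
        mul_zero, add_zero, Complex.star_def, Complex.conj_ofReal, smul_mul_smul_comm, one_mul,
        mul_one, hs, hi, hi2, hi3, one_smul, ← hc]
    exact (add_sub_cancel _ _).symm

/-- On a unital C*-algebra the operator system norm is the C*-norm. -/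
theorem norm_eq_cstar_norm (a : A) : norm a = ‖a‖ :=
  le_antisymm ((norm_le_iff (_root_.norm_nonneg a)).2
    ((normMatrix_mem_iff (_root_.norm_nonneg a) a).2 le_rfl))
    ((normMatrix_mem_iff (norm_nonneg a) a).1 (normMatrix_norm_mem a))

variable {V : Type*} [AddCommGroup V] [Module ℂ V] [StarAddMonoid V] [StarModule ℂ V]
  [OperatorSystem V]

theorem normMatrix_map {φ : V →ₗ[ℂ] A} (hφ : IsUCP φ) (t : ℝ) (x : V) :
    (normMatrix t x).map φ = normMatrix t (φ x) := by
  have h : φ (star x) = star (φ x) := by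
    have h1 := conjTranspose_eq (hφ.map_cone 2 _ (normMatrix_norm_mem x))
    have h2 := congrFun (congrFun h1 1) 0
    simpa [normMatrix] using h2.symm
  ext i j
  fin_cases i <;> fin_cases j <;> simp [-Complex.coe_smul, normMatrix, h, hφ.map_unit]

/-- Unital completely positive maps into C*-algebras are contractive. -/
theorem IsUCP.norm_apply_le {φ : V →ₗ[ℂ] A} (hφ : IsUCP φ) (x : V) : ‖φ x‖ ≤ norm x := by
  rw [← normMatrix_mem_iff (norm_nonneg x), ← normMatrix_map hφ]
  exact hφ.map_cone 2 _ (normMatrix_norm_mem x)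

/-- The operator system norm is the norm pulled back along any unital complete order embedding
into a C*-algebra, for instance into `B(H)`. -/
theorem IsUnitalCompleteOrderEmbedding.norm_apply {φ : V →ₗ[ℂ] A}
    (hφ : IsUnitalCompleteOrderEmbedding φ) (x : V) : ‖φ x‖ = norm x := by
  have h : IsUCP φ := ⟨hφ.map_unit, fun n M => (hφ.map_cone_iff n M).2⟩
  refine le_antisymm (h.norm_apply_le x) ?_
  rw [norm_le_iff (_root_.norm_nonneg _), ← hφ.map_cone_iff, normMatrix_map h]
  exact (normMatrix_mem_iff (_root_.norm_nonneg _) _).2 le_rfl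

end CStar

/-! ### The quotient operator system -/

section Quotient

variable {V : Type*} [AddCommGroup V] [Module ℂ V] [StarAddMonoid V] [StarModule ℂ V]
  [OperatorSystem V]

/-- The vector space `V / J` for a kernel `J`; a type synonym which carries the operator system
structure (and norm) of the quotient operator system. -/
def QuotientSystem (J : Submodule ℂ V) (_hJ : IsKernel J) : Type _ := V ⧸ J

namespace QuotientSystem

variable {J : Submodule ℂ V} {hJ : IsKernel J}

instance : AddCommGroup (QuotientSystem J hJ) := inferInstanceAs (AddCommGroup (V ⧸ J))

instance : Module ℂ (QuotientSystem J hJ) := inferInstanceAs (Module ℂ (V ⧸ J))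

/-- The quotient map `q : V → V / J`. -/
def mk (J : Submodule ℂ V) (hJ : IsKernel J) : V →ₗ[ℂ] QuotientSystem J hJ := J.mkQ

theorem mk_surjective : Function.Surjective (mk J hJ) := J.mkQ_surjective

theorem mk_eq_zero_iff {x : V} : mk J hJ x = 0 ↔ x ∈ J := Submodule.Quotient.mk_eq_zero J

theorem mk_eq_mk_iff {x y : V} : mk J hJ x = mk J hJ y ↔ x - y ∈ J := Submodule.Quotient.eq J

/-- The involution `(x + J)^* = x^* + J`. -/
instance : Star (QuotientSystem J hJ) where
  star := Quotient.map' star fun x y h => by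
    rw [Submodule.quotientRel_def] at h ⊢
    rw [← star_sub]
    exact hJ.star_mem h

theorem star_mk (x : V) : star (mk J hJ x) = mk J hJ (star x) := rfl

instance : StarAddMonoid (QuotientSystem J hJ) where
  star_involutive := by
    intro x
    obtain ⟨x, rfl⟩ := mk_surjective x
    rw [star_mk, star_mk, star_star]
  star_add := by
    intro x y
    obtain ⟨x, rfl⟩ := mk_surjective x
    obtain ⟨y, rfl⟩ := mk_surjective y
    rw [← map_add, star_mk, star_mk, star_mk, ← map_add, star_add]

instance : StarModule ℂ (QuotientSystem J hJ) where
  star_smul := by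
    intro c x
    obtain ⟨x, rfl⟩ := mk_surjective x
    rw [← map_smul, star_mk, star_mk, ← map_smul, star_smul]

/-- The cone `C_n(V / J)`: all `(x_ij + J)` such that for every `ε > 0` some representatives satisfy
`ε e_n + (x_ij + k_ij) ∈ M_n(V)^+`, where `k_ij ∈ J`. -/
def quotCone (J : Submodule ℂ V) (hJ : IsKernel J) (n : ℕ) :
    Set (Matrix (Fin n) (Fin n) (QuotientSystem J hJ)) :=
  {M | ∀ ε : ℝ, 0 < ε → ∃ K : Matrix (Fin n) (Fin n) V,
    K.map (mk J hJ) = M ∧ diagUnit unit n ε + K ∈ cone n}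

theorem exists_lift {n : ℕ} (M : Matrix (Fin n) (Fin n) (QuotientSystem J hJ)) :
    ∃ K : Matrix (Fin n) (Fin n) V, K.map (mk J hJ) = M := by
  choose g hg using fun i j => mk_surjective (M i j)
  exact ⟨Matrix.of g, by ext i j; exact hg i j⟩

theorem map_conjTranspose {n : ℕ} (K : Matrix (Fin n) (Fin n) V) :
    (K.map (mk J hJ))ᴴ = Kᴴ.map (mk J hJ) := by
  ext i j
  simp [star_mk]

theorem map_scalarConj {n m : ℕ} (X : Matrix (Fin n) (Fin m) ℂ) (K : Matrix (Fin n) (Fin n) V) :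
    scalarConj X (K.map (mk J hJ)) = (scalarConj X K).map (mk J hJ) := by
  ext i j
  simp [scalarConj]

theorem map_diagUnit (n : ℕ) (r : ℝ) :
    (diagUnit (unit : V) n r).map (mk J hJ) = diagUnit (mk J hJ unit) n r := by
  ext i j
  by_cases hij : i = j
  · subst hij
    simp [-Complex.coe_smul, diagUnit]
  · simp [diagUnit, hij]

theorem diagUnit_add (n : ℕ) (r s : ℝ) :
    diagUnit (unit : V) n (r + s) = diagUnit unit n r + diagUnit unit n s := by
  ext i j
  by_cases hij : i = j
  · subst hij
    simp [-Complex.coe_smul, diagUnit, add_smul]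
  · simp [diagUnit, hij]

theorem diagUnit_conjTranspose (n : ℕ) (r : ℝ) :
    (diagUnit (unit : V) n r)ᴴ = diagUnit unit n r := by
  rw [diagUnit, Matrix.diagonal_conjTranspose]
  congr 1
  ext i
  simp [-Complex.coe_smul, star_smul, star_unit]

theorem smul_diagUnit (n : ℕ) (r s : ℝ) :
    (r : ℂ) • diagUnit (unit : V) n s = diagUnit unit n (r * s) := by
  ext i j
  by_cases hij : i = j
  · subst hij
    simp [-Complex.coe_smul, diagUnit, smul_smul]
  · simp [diagUnit, hij]

/-- The quotient operator system `(V / J, {C_n(V / J)}, e + J)`. -/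
instance : OperatorSystem (QuotientSystem J hJ) where
  unit := mk J hJ unit
  cone := quotCone J hJ
  star_unit := by rw [star_mk, star_unit]
  conjTranspose_eq := by
    intro n M hM
    obtain ⟨K, rfl, hK⟩ := hM 1 one_pos
    have h := conjTranspose_eq hK
    rw [Matrix.conjTranspose_add, diagUnit_conjTranspose] at h
    rw [map_conjTranspose, add_left_cancel h]
  zero_mem n ε hε := ⟨0, by ext; simp, by simpa using diagUnit_mem n hε.le⟩
  add_mem := by
    intro n M N hM hN ε hε
    obtain ⟨K, rfl, hK⟩ := hM (ε / 2) (half_pos hε)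
    obtain ⟨L, rfl, hL⟩ := hN (ε / 2) (half_pos hε)
    refine ⟨K + L, by ext; simp, ?_⟩
    convert add_mem hK hL using 1
    rw [← add_halves ε, diagUnit_add, add_halves]
    abel
  smul_mem := by
    intro n M r hr hM ε hε
    rcases hr.eq_or_lt with rfl | hr
    · exact ⟨0, by ext; simp, by simpa using diagUnit_mem n hε.le⟩
    obtain ⟨K, rfl, hK⟩ := hM (ε / r) (div_pos hε hr)
    refine ⟨(r : ℂ) • K, by ext; simp [-Complex.coe_smul], ?_⟩
    convert smul_mem hr.le hK using 1
    rw [smul_add, smul_diagUnit, mul_div_cancel₀ _ hr.ne']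
  eq_zero := by
    intro n M h1 h2
    obtain ⟨K, rfl⟩ := exists_lift M
    ext i j
    refine mk_eq_zero_iff.2 (hJ.mem_of_approx (M := K) (fun ε hε => ?_) (fun ε hε => ?_) i j)
    · obtain ⟨L, hL, h⟩ := h1 ε hε
      exact ⟨L, fun i j => (mk_eq_mk_iff (hJ := hJ)).1 (congrFun (congrFun hL i) j), h⟩
    · obtain ⟨L, hL, h⟩ := h2 ε hε
      refine ⟨L, fun i j => (mk_eq_mk_iff (hJ := hJ)).1 ?_, h⟩
      rw [Matrix.neg_apply, map_neg]
      exact congrFun (congrFun hL i) j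
  scalarConj_mem := by
    intro n m X M hM ε hε
    obtain ⟨s, hs, h⟩ := exists_le_unit (scalarConj X (diagUnit (unit : V) n 1)) (by
      ext i j
      have := congrFun (congrFun (conjTranspose_eq
        (scalarConj_mem X (diagUnit_mem (V := V) n zero_le_one))) i) j
      exact this)
    obtain ⟨K, rfl, hK⟩ := hM (ε / s) (div_pos hε hs)
    refine ⟨scalarConj X K, (map_scalarConj X K).symm, ?_⟩
    have h1 := smul_mem (div_pos hε hs).le h
    have h2 := scalarConj_mem X hK
    convert add_mem h1 h2 using 1
    rw [scalarConj_add, smul_sub, smul_diagUnit, div_mul_cancel₀ _ hs.ne', ← scalarConj_smul,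
      smul_diagUnit, mul_one]
    abel
  exists_le_unit := by
    intro n M hM
    obtain ⟨K, rfl⟩ := exists_lift M
    obtain ⟨r, hr, h⟩ := exists_le_unit (((1 / 2 : ℝ) : ℂ) • (K + Kᴴ)) (by
      rw [Matrix.conjTranspose_smul, Matrix.conjTranspose_add, Matrix.conjTranspose_conjTranspose,
        add_comm]
      congr 1
      simp)
    refine ⟨r, hr, fun ε hε => ⟨_, ?_, add_mem (diagUnit_mem n hε.le) h⟩⟩
    have h2 : (((1 / 2 : ℝ) : ℂ) • (K + Kᴴ)).map (mk J hJ) = K.map (mk J hJ) := by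
      rw [map_conjTranspose] at hM
      ext i j
      have h3 := congrFun (congrFun hM i) j
      simp only [Matrix.map_apply] at h3
      simp only [Matrix.map_apply, Matrix.smul_apply, Matrix.add_apply, map_smul, map_add, h3]
      rw [← two_smul ℂ, smul_smul]
      simp
    rw [← h2, ← map_diagUnit]
    ext i j
    simp only [Matrix.map_apply, Matrix.sub_apply, map_sub]
  archimedean := by
    intro n M hM ε hε
    obtain ⟨K, hK, h⟩ := hM (ε / 2) (half_pos hε) (ε / 2) (half_pos hε)
    refine ⟨K - diagUnit unit n (ε / 2), ?_, ?_⟩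
    · have h1 : (K - diagUnit unit n (ε / 2)).map (mk J hJ) =
          K.map (mk J hJ) - (diagUnit unit n (ε / 2)).map (mk J hJ) := by
        ext i j
        simp only [Matrix.map_apply, Matrix.sub_apply, map_sub]
      rw [h1, hK, map_diagUnit]
      abel
    · convert h using 1
      rw [← add_halves ε, diagUnit_add, add_halves]
      abel

theorem isUCP_mk : IsUCP (mk J hJ) where
  map_unit := rfl
  map_cone _ M hM _ hε := ⟨M, rfl, add_mem (diagUnit_mem _ hε.le) hM⟩

/-- A kernel is the kernel of a unital completely positive map into an operator system. -/
theorem _root_.OperatorSystem.IsKernel.eq_ker_mk (hJ : IsKernel J) :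
    IsUCP (mk J hJ) ∧ LinearMap.ker (mk J hJ) = J ∧ (unit : QuotientSystem J hJ) ≠ 0 := by
  refine ⟨isUCP_mk, J.ker_mkQ, fun h => ?_⟩
  have h1 : (unit : V) ∈ J := mk_eq_zero_iff.1 h
  obtain ⟨F, ⟨f, hf⟩, hF, rfl⟩ := hJ
  simp only [Submodule.mem_iInf, LinearMap.mem_ker] at h1
  simpa [(hF f hf).map_unit] using h1 f hf

/-- The norm `‖·‖_osy` of the quotient operator system. -/
instance : Norm (QuotientSystem J hJ) := ⟨OperatorSystem.norm⟩

theorem normedSpaceCore : NormedSpace.Core ℂ (QuotientSystem J hJ) where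
  norm_nonneg := OperatorSystem.norm_nonneg
  norm_smul c x := by
    refine le_antisymm (OperatorSystem.norm_smul_le c x) ?_
    rcases eq_or_ne c 0 with rfl | hc
    · rw [_root_.norm_zero, zero_mul]
      exact OperatorSystem.norm_nonneg _
    have h := OperatorSystem.norm_smul_le c⁻¹ (c • x)
    rw [smul_smul, inv_mul_cancel₀ hc, one_smul, norm_inv,
      ← div_eq_inv_mul, le_div_iff₀' (norm_pos_iff.2 hc)] at h
    exact h
  norm_triangle := OperatorSystem.norm_add_le
  norm_eq_zero_iff x := ⟨OperatorSystem.eq_zero_of_norm_eq_zero, by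
    rintro rfl
    exact OperatorSystem.norm_zero⟩

instance : NormedAddCommGroup (QuotientSystem J hJ) := .ofCore normedSpaceCore

instance : NormedSpace ℂ (QuotientSystem J hJ) := .ofCore normedSpaceCore

end QuotientSystem

end Quotient

/-! ### The universal C*-algebra of an operator system -/

section Universal

/-- A unital completely positive map of `V` into `B(H)` for some non-zero Hilbert space `H`. -/
structure UCPRep (V : Type u) [AddCommGroup V] [Module ℂ V] [StarAddMonoid V] [StarModule ℂ V]
    [OperatorSystem V] : Type (u + 1) where
  H : Type u
  [normedAddCommGroup : NormedAddCommGroup H]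
  [innerProductSpace : InnerProductSpace ℂ H]
  [completeSpace : CompleteSpace H]
  [nontrivial : Nontrivial H]
  toLinearMap : V →ₗ[ℂ] (H →L[ℂ] H)
  isUCP : IsUCP toLinearMap

attribute [instance] UCPRep.normedAddCommGroup UCPRep.innerProductSpace UCPRep.completeSpace
  UCPRep.nontrivial

variable (V : Type u) [AddCommGroup V] [Module ℂ V] [StarAddMonoid V] [StarModule ℂ V]
  [OperatorSystem V]

/-- The `ℓ^∞`-product of the algebras `B(H)` over all unital completely positive `φ : V → B(H)`. -/
abbrev UCPProduct : Type (u + 1) := lp (fun ρ : UCPRep V => ρ.H →L[ℂ] ρ.H) ∞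

instance : CStarAlgebra (UCPProduct V) where

/-- The map `x ↦ (φ(x))_φ`. -/
def toUCPProduct : V →ₗ[ℂ] UCPProduct V where
  toFun x := ⟨fun ρ => ρ.toLinearMap x, memℓp_infty ⟨norm x, by
    rintro _ ⟨ρ, rfl⟩
    exact ρ.isUCP.norm_apply_le x⟩⟩
  map_add' x y := by
    ext1
    funext ρ
    exact map_add ρ.toLinearMap x y
  map_smul' c x := by
    ext1
    funext ρ
    exact map_smul ρ.toLinearMap c x

/-- The universal C*-algebra `C*_u(V)`: the completion of the free `*`-algebra on `V` in the
seminorm `‖u‖ = sup_φ ‖π_φ(u)‖`, realised as the closed `*`-subalgebra of the `ℓ^∞`-product of all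
`B(H)` that is generated by the elements `(φ(x))_φ`, `x ∈ V`. -/
def universalCStar : StarSubalgebra ℂ (UCPProduct V) :=
  (StarAlgebra.adjoin ℂ (Set.range (toUCPProduct V))).topologicalClosure

/-- The type of elements of `C*_u(V)`. -/
abbrev UniversalCStar : Type (u + 1) := universalCStar V

instance isClosed_universalCStar : IsClosed (universalCStar V : Set (UCPProduct V)) :=
  StarSubalgebra.isClosed_topologicalClosure _

/-- The canonical map `V → C*_u(V)`. -/
def toUniversalCStar : V →ₗ[ℂ] UniversalCStar V :=
  (toUCPProduct V).codRestrict (universalCStar V).toSubalgebra.toSubmodule fun x =>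
    StarSubalgebra.le_topologicalClosure _ (StarAlgebra.subset_adjoin ℂ _ ⟨x, rfl⟩)

/-- Every unital completely positive map `V → B(H)` extends to a `*`-homomorphism on `C*_u(V)`. -/
theorem exists_extension (ρ : UCPRep V) : ∃ π : UniversalCStar V →⋆ₐ[ℂ] (ρ.H →L[ℂ] ρ.H),
    ∀ x : V, π (toUniversalCStar V x) = ρ.toLinearMap x :=
  ⟨{ toFun := fun a => (a : UCPProduct V) ρ
     map_one' := rfl
     map_mul' := fun _ _ => rfl
     map_zero' := rfl
     map_add' := fun _ _ => rfl
     commutes' := fun _ => rfl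
     map_star' := fun _ => rfl }, fun _ => rfl⟩

variable {V}

/-- The closed two-sided ideal `⟨S⟩` of a C*-algebra `B` generated by a set `S`, as a subspace. -/
def closedIdeal {B : Type*} [CStarAlgebra B] (S : Set B) : Submodule ℂ B :=
  sInf {I | S ⊆ I ∧ IsClosed (I : Set B) ∧ ∀ x ∈ I, ∀ b : B, b * x ∈ I ∧ x * b ∈ I}

/-- The C*-quotient `C*_u(V) / ⟨J⟩`; its topology is the one of the quotient norm. -/
abbrev UniversalQuotient (J : Submodule ℂ V) : Type (u + 1) :=
  UniversalCStar V ⧸ closedIdeal (toUniversalCStar V '' (J : Set V))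

/-- The map `V → C*_u(V) / ⟨J⟩`, `x ↦ x + ⟨J⟩`. -/
def toUniversalQuotient (J : Submodule ℂ V) : V →ₗ[ℂ] UniversalQuotient J :=
  (closedIdeal (toUniversalCStar V '' (J : Set V))).mkQ ∘ₗ toUniversalCStar V

end Universal

end OperatorSystem

/-- The C*-algebra `ℓ^∞(ℕ, ℓ^∞_4)`: the `ℓ^∞`-sum of countably many copies of `ℓ^∞_4`. -/
abbrev LInftySum : Type := lp (fun _ : ℕ => Fin 4 → ℂ) ∞

end

noncomputable section

/-! ### Estimates in C*-algebras -/

section CStarEstimates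

variable {B : Type*} [CStarAlgebra B]

/-! Put `δ = 1 / (n + 1)`, let `p` be the projection onto coordinate `0` of the `n`-th summand
(`spike n`) and `k = (1, 1, -δ, -δ)` in that summand (`kernelVector n`). The kernel `J` consists of
the `x` with every `x_n` a multiple of `(1, 1, -δ, -δ)`. Both big coordinates of an element of `J`
agree, so it cannot approximate `p`, which is `1` at one and `0` at the other: `p` has distance at
least `1/2` from `J` (`half_le_norm_spike_add`). In order terms `p` is nevertheless small modulo
`J`, because `0 ≤ p ≤ δ + k` and `k ∈ J`; so its class has operator system norm at most `δ`
(`norm_mk_spike_le`). As `δ → 0`, the two norms are inequivalent.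

The same inequality survives in `C*_u(A)`. If `0 ≤ a ≤ d + b` with `b` in an ideal, then `a` is
within `4 d` of that ideal (`exists_mem_norm_add_le`), so the class of `p` modulo `⟨J⟩` has norm at
most `4 δ`.

Non-completeness and the non-closed range are then two uses of the open mapping theorem. Either
completeness or closedness would give preimages of the class of `p` of norm `O(δ)`; but these
preimages lie in `p + J`, hence have norm at least `1/2` (`not_exists_preimage_norm_le`). For the
map into `C*_u(A) / ⟨J⟩` this requires that no element of `A` outside `J` falls into `⟨J⟩`
(`apply_eq_zero_of_mem_closedIdeal`). -/

theorem nonneg_of_norm_smul_one_sub_le [PartialOrder B] [StarOrderedRing B] {y : B}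
    (hy : IsSelfAdjoint y) {r : ℝ} (h : ‖r • (1 : B) - y‖ ≤ r) : 0 ≤ y := by
  have h1 : IsSelfAdjoint (r • (1 : B) - y) := ((IsSelfAdjoint.all r).smul (.one B)).sub hy
  have h2 := h1.le_algebraMap_norm_self.trans (algebraMap_mono B h)
  rw [Algebra.algebraMap_eq_smul_one] at h2
  simpa using h2

/-- If `0 ≤ a ≤ d + b` with `b` in a two-sided ideal `I`, then the distance from `a` to `I` is
at most `4 d`. -/
theorem exists_mem_norm_add_le [PartialOrder B] [StarOrderedRing B] {I : Submodule ℂ B}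
    (hI : ∀ x ∈ I, ∀ c : B, c * x ∈ I ∧ x * c ∈ I) {a b : B} {d : ℝ} (hd : 0 < d)
    (hb : b ∈ I) (ha : 0 ≤ a) (hab : a ≤ d • (1 : B) + b) :
    ∃ z ∈ I, ‖a + z‖ ≤ 4 * d := by
  -- Since `d + b ≥ a ≥ 0`, one more `d` gives `v = 2d + b ≥ d`; hence `v` is invertible with `v⁻¹ ≤
  -- 1 / d`.
  have hs0 : d • (1 : B) ≤ (2 * d) • (1 : B) + b := by
    rw [two_mul, add_smul, add_assoc]
    exact le_add_of_nonneg_right (ha.trans hab)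
  have hsp : IsStrictlyPositive (d • (1 : B)) :=
    IsStrictlyPositive.smul hd (by simp)
  let v : Bˣ := (CStarAlgebra.isUnit_of_le _ hs0 hsp).unit
  let w : Bˣ := hsp.isUnit.unit
  have hv : (v : B) = (2 * d) • (1 : B) + b := rfl
  have hw : (w : B) = d • (1 : B) := rfl
  have hwi : ((w⁻¹ : Bˣ) : B) = d⁻¹ • (1 : B) := by
    refine Units.inv_eq_of_mul_eq_one_right ?_
    rw [hw, smul_mul_smul_comm, mul_one,
      mul_inv_cancel₀ hd.ne', one_smul]
  have hle : ((v⁻¹ : Bˣ) : B) ≤ d⁻¹ • (1 : B) := by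
    rw [← hwi]
    exact CStarAlgebra.inv_le_inv (hw ▸ hsp.nonneg) hs0
  have hvpos : 0 ≤ (v : B) := hsp.nonneg.trans hs0
  have hvi : 0 ≤ ((v⁻¹ : Bˣ) : B) := CFC.inv_nonneg_of_nonneg v hvpos
  have hvsa : IsSelfAdjoint ((v⁻¹ : Bˣ) : B) := .of_nonneg hvi
  have hbv : b * ((v⁻¹ : Bˣ) : B) = 1 - (2 * d) • ((v⁻¹ : Bˣ) : B) := by
    have := v.mul_inv
    rw [hv, add_mul, smul_one_mul] at this
    rw [← this]
    abel
  have hvb : ((v⁻¹ : Bˣ) : B) * b = 1 - (2 * d) • ((v⁻¹ : Bˣ) : B) := by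
    have := v.inv_mul
    rw [hv, mul_add, mul_smul_one] at this
    rw [← this]
    abel
  set t : B := ((v⁻¹ : Bˣ) : B) with ht
  -- Modulo `I` the element `v` equals `2d`, so `u = 2d v⁻¹` equals `1`; thus `u a u` is a
  -- representative of `a + I`.
  let u : B := (2 * d) • t
  have hu : IsSelfAdjoint u := (IsSelfAdjoint.all _).smul hvsa
  have hua : 0 ≤ u * a * u := by
    simpa [hu.star_eq] using star_left_conjugate_nonneg ha u
  -- Here `a ≤ v` gives `u a u ≤ u v u = 4d² v⁻¹ ≤ 4d`.
  have hu2 : u * a * u ≤ (4 * d) • (1 : B) := by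
    calc u * a * u ≤ u * v * u := hu.conjugate_le_conjugate
          (hab.trans (by
            rw [hv, two_mul, add_smul, add_assoc]
            exact le_add_of_nonneg_left hsp.nonneg))
      _ = (4 * d ^ 2) • t := by
          simp only [u, smul_mul_assoc, mul_smul_comm, smul_smul]
          rw [ht, Units.inv_mul, one_mul]
          congr 1
          ring
      _ ≤ (4 * d ^ 2) • (d⁻¹ • (1 : B)) := smul_le_smul_of_nonneg_left hle (by positivity)
      _ = (4 * d) • (1 : B) := by
          rw [smul_smul]
          congr 1
          field_simp
  refine ⟨u * a * u - a, ?_, ?_⟩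
  · have h2 : u * a * u - a = -(t * b * (a * u)) - a * (b * t) := by
      rw [hvb, hbv]
      change _ = -((1 - u) * (a * u)) - a * (1 - u)
      simp only [sub_mul, mul_sub, one_mul, mul_one, mul_assoc]
      abel
    rw [h2, mul_assoc]
    exact I.sub_mem (I.neg_mem (hI _ (hI _ hb _).2 _).1) (hI _ (hI _ hb _).2 _).1
  · rw [add_sub_cancel]
    exact (CStarAlgebra.norm_le_iff_le_algebraMap _ (by positivity) hua).2
      (by rwa [Algebra.algebraMap_eq_smul_one])

end CStarEstimates

namespace OperatorSystem

/-! ### Operator system norms and unital completely positive maps -/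

section General

variable {V : Type*} [AddCommGroup V] [Module ℂ V] [StarAddMonoid V] [StarModule ℂ V]
  [OperatorSystem V]

/-- The matrix `[[t, x], [x, t]]` is half the sum of the compressions of `t + x` by the row `(1, 1)`
and of `t - x` by the row `(1, -1)`. -/
theorem normMatrix_mem_of_abs_le {x : V} (hx : star x = x) {t : ℝ}
    (h1 : (Matrix.of fun _ _ : Fin 1 => (t : ℂ) • (unit : V) + x) ∈ cone 1)
    (h2 : (Matrix.of fun _ _ : Fin 1 => (t : ℂ) • (unit : V) - x) ∈ cone 1) :
    normMatrix t x ∈ cone 2 := by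
  have h3 := smul_mem (r := 1 / 2) (by norm_num) (add_mem
    (scalarConj_mem (!![1, 1] : Matrix (Fin 1) (Fin 2) ℂ) h1)
    (scalarConj_mem (!![1, -1] : Matrix (Fin 1) (Fin 2) ℂ) h2))
  convert h3 using 1
  have h4 : (2 : ℂ)⁻¹ + 2⁻¹ = 1 := by norm_num
  ext i j
  fin_cases i <;> fin_cases j <;>
    simp [-Complex.coe_smul, normMatrix, scalarConj, hx, smul_smul] <;> module

variable {A : Type*} [CStarAlgebra A]

theorem of_mem_cone_one_of_nonneg [PartialOrder A] [StarOrderedRing A] {a : A} (ha : 0 ≤ a) :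
    (Matrix.of fun _ _ : Fin 1 => a) ∈ cone (V := A) 1 := by
  obtain ⟨b, rfl⟩ := (nonneg_iff_exists_star_mul _).1 ha
  refine ⟨Matrix.of fun _ _ => b, ?_⟩
  ext i j
  simp [Matrix.mul_apply]

theorem isUCP_of_starAlgHom {B : Type*} [CStarAlgebra B] (π : A →⋆ₐ[ℂ] B) :
    IsUCP (V := A) (W := B) (π : A →ₗ[ℂ] B) where
  map_unit := map_one π
  map_cone := by
    rintro n _ ⟨N, rfl⟩
    refine ⟨N.map π, ?_⟩
    ext i j
    simp only [Matrix.map_apply, Matrix.mul_apply, Matrix.conjTranspose_apply, map_sum]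
    exact Finset.sum_congr rfl fun k _ => (map_mul π _ _).trans (by rw [map_star])

theorem IsUCP.convexComb {φ ψ : V →ₗ[ℂ] A} (hφ : IsUCP φ) (hψ : IsUCP ψ) {r s : ℝ} (hr : 0 ≤ r)
    (hs : 0 ≤ s) (hrs : r + s = 1) : IsUCP ((r : ℂ) • φ + (s : ℂ) • ψ) where
  map_unit := by
    simp only [LinearMap.add_apply, LinearMap.smul_apply, hφ.map_unit, hψ.map_unit]
    rw [← add_smul, ← Complex.ofReal_add, hrs, Complex.ofReal_one, one_smul]
  map_cone n M hM := add_mem (smul_mem hr (hφ.map_cone n M hM)) (smul_mem hs (hψ.map_cone n M hM))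

theorem IsUCP.comp {W X : Type*} [AddCommGroup W] [Module ℂ W] [StarAddMonoid W] [StarModule ℂ W]
    [OperatorSystem W] [AddCommGroup X] [Module ℂ X] [StarAddMonoid X] [StarModule ℂ X]
    [OperatorSystem X] {ψ : W →ₗ[ℂ] X} {φ : V →ₗ[ℂ] W} (hψ : IsUCP ψ) (hφ : IsUCP φ) :
    IsUCP (ψ ∘ₗ φ) where
  map_unit := by simp [hφ.map_unit, hψ.map_unit]
  map_cone n M hM := hψ.map_cone n _ (hφ.map_cone n M hM)

theorem IsUCP.isState {f : V →ₗ[ℂ] ℂ} (hf : IsUCP f) : IsState f where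
  map_unit := hf.map_unit
  nonneg v hv := by
    obtain ⟨N, hN⟩ := hf.map_cone 1 _ hv
    have h := congrFun (congrFun hN 0) 0
    simp only [Matrix.map_apply, Matrix.of_apply, Matrix.mul_apply, Finset.univ_unique,
      Finset.sum_singleton, Matrix.conjTranspose_apply, Complex.star_def] at h
    rw [h, ← Complex.normSq_eq_conj_mul_self]
    exact ⟨by simpa using Complex.normSq_nonneg _, Complex.ofReal_im _⟩

theorem norm_mk_le {J : Submodule ℂ A} {hJ : IsKernel J} (x : A) :
    ‖QuotientSystem.mk J hJ x‖ ≤ ‖x‖ := by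
  rw [← norm_eq_cstar_norm]
  refine (norm_le_iff (norm_nonneg x)).2 ?_
  convert (QuotientSystem.isUCP_mk (hJ := hJ)).map_cone 2 _ (normMatrix_norm_mem x) using 1
  ext i j
  fin_cases i <;> fin_cases j <;>
    simp [-Complex.coe_smul, normMatrix, QuotientSystem.star_mk] <;> rfl

end General

/-! ### The universal C*-algebra and its closed ideals -/

section Universal

variable {A : Type} [CStarAlgebra A]

theorem norm_toUniversalCStar_le (x : A) : ‖toUniversalCStar A x‖ ≤ ‖x‖ := by
  refine lp.norm_le_of_forall_le (_root_.norm_nonneg x) fun ρ => ?_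
  rw [← norm_eq_cstar_norm x]
  exact ρ.isUCP.norm_apply_le x

theorem toUniversalCStar_one : toUniversalCStar A (1 : A) = 1 := by
  apply Subtype.ext
  apply lp.ext
  funext ρ
  exact ρ.isUCP.map_unit

set_option synthInstance.maxHeartbeats 200000 in
theorem star_toUniversalCStar (x : A) :
    star (toUniversalCStar A x) = toUniversalCStar A (star x) := by
  apply Subtype.ext
  apply lp.ext
  funext ρ
  -- The image of a positive matrix with off-diagonal entries `x` and `star x` is self-adjoint;
  -- comparing those entries shows that each representation respects the involution.
  have h1 := conjTranspose_eq (ρ.isUCP.map_cone 2 _ (normMatrix_norm_mem x))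
  have h2 := congrFun (congrFun h1 1) 0
  have h3 : ρ.toLinearMap (star x) = star (ρ.toLinearMap x) := by simpa [normMatrix] using h2.symm
  exact h3.symm

theorem closedIdeal_mul_mem {B : Type*} [CStarAlgebra B] {S : Set B} {x : B}
    (hx : x ∈ closedIdeal S) (b : B) : b * x ∈ closedIdeal S ∧ x * b ∈ closedIdeal S := by
  simp only [closedIdeal, Submodule.mem_sInf] at hx ⊢
  exact ⟨fun I hI => (hI.2.2 x (hx I hI) b).1, fun I hI => (hI.2.2 x (hx I hI) b).2⟩

theorem subset_closedIdeal {B : Type*} [CStarAlgebra B] (S : Set B) :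
    S ⊆ closedIdeal S := by
  intro x hx
  simp only [closedIdeal, SetLike.mem_coe, Submodule.mem_sInf]
  exact fun I hI => hI.1 hx

theorem isClosed_closedIdeal {B : Type*} [CStarAlgebra B] (S : Set B) :
    IsClosed (closedIdeal S : Set B) := by
  rw [closedIdeal, Submodule.coe_sInf]
  exact isClosed_biInter fun I hI => hI.2.1

open scoped CStarAlgebra in
/-- A unital completely positive scalar functional that annihilates `J` also annihilates every
element of the ideal of `C*_u(A)` generated by `J` that comes from `A`. -/
theorem apply_eq_zero_of_mem_closedIdeal {J : Submodule ℂ A} {x : A}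
    (hx : toUniversalCStar A x ∈ closedIdeal (toUniversalCStar A '' (J : Set A)))
    {f : A →ₗ[ℂ] ℂ} (hf : IsUCP f) (hfJ : ∀ y ∈ J, f y = 0) : f x = 0 := by
  -- The functional `f` becomes a representation on the one-dimensional Hilbert space `ℂ`, with
  -- scalars acting by multiplication.
  let ρ : UCPRep A :=
    { H := ℂ
      toLinearMap := ((StarAlgHom.ofId ℂ (ℂ →L[ℂ] ℂ) : ℂ →⋆ₐ[ℂ] (ℂ →L[ℂ] ℂ)) :
        ℂ →ₗ[ℂ] (ℂ →L[ℂ] ℂ)) ∘ₗ f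
      isUCP := (isUCP_of_starAlgHom _).comp hf }
  have hρ (y : A) : ρ.toLinearMap y = f y • 1 := rfl
  obtain ⟨π, hπ⟩ := exists_extension A ρ
  -- The kernel of the `*`-homomorphism `π` is a closed two-sided ideal containing the image of `J`,
  -- so it contains the ideal generated by that image.
  have hker : toUniversalCStar A x ∈ LinearMap.ker
      π.toAlgHom.toLinearMap := by
    refine Submodule.mem_sInf.1 hx _ ⟨?_, ?_, ?_⟩
    · rintro _ ⟨y, hy, rfl⟩
      exact (hπ y).trans (by rw [hρ, hfJ y hy, zero_smul])
    · exact isClosed_singleton.preimage (map_continuous π)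
    · intro y hy b
      have hy' : π y = 0 := hy
      exact ⟨show π (b * y) = 0 by rw [map_mul, hy', mul_zero],
        show π (y * b) = 0 by rw [map_mul, hy', zero_mul]⟩
  have h : f x • (1 : ℂ →L[ℂ] ℂ) = 0 := (hπ x).symm.trans hker
  simpa using congrArg (fun T : ℂ →L[ℂ] ℂ => T 1) h

end Universal

end OperatorSystem

/-! ### The kernel in `ℓ^∞(ℕ, ℓ^∞_4)` -/

namespace LInftySum

open OperatorSystem

/-- The character `x ↦ x_n(i)`. -/
def eval (n : ℕ) (i : Fin 4) : LInftySum →⋆ₐ[ℂ] ℂ where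
  toFun x := x n i
  map_one' := rfl
  map_mul' _ _ := rfl
  map_zero' := rfl
  map_add' _ _ := rfl
  commutes' _ := rfl
  map_star' _ := rfl

theorem ext_eval {x y : LInftySum} (h : ∀ n i, x n i = y n i) : x = y :=
  lp.ext (funext fun n => funext (h n))

theorem norm_le {x : LInftySum} {r : ℝ} (hr : 0 ≤ r) (h : ∀ n i, ‖x n i‖ ≤ r) : ‖x‖ ≤ r :=
  lp.norm_le_of_forall_le hr fun n => (pi_norm_le_iff_of_nonneg hr).2 (h n)

theorem norm_apply_le (x : LInftySum) (n : ℕ) (i : Fin 4) : ‖x n i‖ ≤ ‖x‖ :=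
  (norm_le_pi_norm (x n) i).trans (lp.norm_apply_le_norm (by simp) x n)

/-! ### The states and their joint kernel -/

/-- The weight `1 / (n + 1)` used in the `n`-th coordinate. -/
def weight (n : ℕ) : ℝ := 1 / (n + 1)

theorem weight_pos (n : ℕ) : 0 < weight n := by
  unfold weight
  positivity

theorem weight_le_one (n : ℕ) : weight n ≤ 1 := by
  unfold weight
  rw [div_le_one (by positivity)]
  linarith [(Nat.cast_nonneg n : (0 : ℝ) ≤ n)]

/-- The state `x ↦ (δ x_n(i) + x_n(j)) / (1 + δ)`, where `δ = 1 / (n + 1)`. -/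
def pairState (n : ℕ) (i j : Fin 4) : LInftySum →ₗ[ℂ] ℂ :=
  ((weight n / (1 + weight n) : ℝ) : ℂ) • (eval n i).toAlgHom.toLinearMap +
    ((1 / (1 + weight n) : ℝ) : ℂ) • (eval n j).toAlgHom.toLinearMap

theorem isUCP_pairState (n : ℕ) (i j : Fin 4) : IsUCP (pairState n i j) := by
  have h := weight_pos n
  exact (isUCP_of_starAlgHom (eval n i)).convexComb (isUCP_of_starAlgHom (eval n j))
    (by positivity) (by positivity) (by rw [← add_div, add_comm, div_self (by positivity)])

theorem pairState_eq_zero_iff {n : ℕ} {i j : Fin 4} {x : LInftySum} :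
    pairState n i j x = 0 ↔ x n j = -(weight n * x n i) := by
  have h : ((1 + weight n : ℝ) : ℂ) ≠ 0 := by
    exact_mod_cast (by linarith [weight_pos n] : (1 + weight n : ℝ) ≠ 0)
  have h1 : pairState n i j x = (weight n * x n i + x n j) / ((1 + weight n : ℝ) : ℂ) := by
    change ((weight n / (1 + weight n) : ℝ) : ℂ) * x n i + ((1 / (1 + weight n) : ℝ) : ℂ) * x n j = _
    rw [Complex.ofReal_div, Complex.ofReal_div, Complex.ofReal_one]
    field_simp
  rw [h1, div_eq_zero_iff, or_iff_left h, eq_neg_iff_add_eq_zero, add_comm]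

/-- The states `pairState n i j` with `i ∈ {0, 1}` and `j ∈ {2, 3}`. -/
def pairStates : Set (LInftySum →ₗ[ℂ] ℂ) :=
  {f | ∃ (n : ℕ) (i j : Fin 4), i < 2 ∧ 2 ≤ j ∧ f = pairState n i j}

/-- The joint kernel of the states `pairState n i j`, that is, the space of all `x` with
`x_n ∈ ℂ (1, 1, -δ, -δ)`, `δ = 1 / (n + 1)`, for all `n`. -/
def pairKernel : Submodule ℂ LInftySum := ⨅ f ∈ pairStates, LinearMap.ker f

theorem isUCP_of_mem_pairStates {f : LInftySum →ₗ[ℂ] ℂ} (hf : f ∈ pairStates) : IsUCP f := by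
  obtain ⟨n, i, j, -, -, rfl⟩ := hf
  exact isUCP_pairState n i j

theorem isKernel_pairKernel : IsKernel pairKernel :=
  ⟨pairStates, ⟨_, 0, 0, 2, by decide, le_rfl, rfl⟩,
    fun _ hf => (isUCP_of_mem_pairStates hf).isState, rfl⟩

theorem mem_pairKernel_iff {x : LInftySum} :
    x ∈ pairKernel ↔ ∀ n, ∀ i < 2, ∀ j ≥ 2, x n j = -(weight n * x n i) := by
  simp only [pairKernel, Submodule.mem_iInf, LinearMap.mem_ker]
  constructor
  · exact fun h n i hi j hj => pairState_eq_zero_iff.1 (h _ ⟨n, i, j, hi, hj, rfl⟩)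
  · rintro h _ ⟨n, i, j, hi, hj, rfl⟩
    exact pairState_eq_zero_iff.2 (h n i hi j hj)

/-! ### The projections far from the kernel -/

/-- The projection onto the coordinate `0` of the `n`-th summand. -/
def spike (n : ℕ) : LInftySum := lp.single ∞ n ![1, 0, 0, 0]

/-- The element `(1, 1, -δ, -δ)` of the `n`-th summand. -/
def kernelVector (n : ℕ) : LInftySum := lp.single ∞ n ![1, 1, -weight n, -weight n]

theorem kernelVector_mem (n : ℕ) : kernelVector n ∈ pairKernel := by
  rw [mem_pairKernel_iff]
  intro m i hi j hj
  rcases eq_or_ne m n with rfl | hm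
  · rw [kernelVector, lp.single_apply_self]
    fin_cases i <;> fin_cases j <;> simp_all
  · rw [kernelVector, lp.single_apply_ne _ _ _ hm]
    simp

/-- Coordinates `0` and `1` of `y n` are a common number `c`, because coordinate `2` is `-δ` times
each of them and `δ ≠ 0`. The sum therefore has entries `1 + c` and `c`, which cannot both be
smaller than `1/2` in modulus. -/
theorem half_le_norm_spike_add (n : ℕ) {y : LInftySum} (hy : y ∈ pairKernel) :
    1 / 2 ≤ ‖spike n + y‖ := by
  rw [mem_pairKernel_iff] at hy
  have h1 := hy n 0 (by decide) 2 (by decide)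
  have h2 := hy n 1 (by decide) 2 (by decide)
  have hw : (weight n : ℂ) ≠ 0 := by exact_mod_cast (weight_pos n).ne'
  have h3 : y n 0 = y n 1 := mul_left_cancel₀ hw (neg_injective (h1.symm.trans h2))
  have h4 := norm_apply_le (spike n + y) n 0
  have h5 := norm_apply_le (spike n + y) n 1
  have e4 : (spike n + y : LInftySum) n 0 = 1 + y n 1 := by
    rw [lp.coeFn_add, Pi.add_apply, Pi.add_apply, spike, lp.single_apply_self, h3]
    simp
  have e5 : (spike n + y : LInftySum) n 1 = y n 1 := by
    rw [lp.coeFn_add, Pi.add_apply, Pi.add_apply, spike, lp.single_apply_self]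
    simp
  rw [e4] at h4
  rw [e5] at h5
  have h6 : ‖(1 : ℂ)‖ ≤ ‖1 + y n 1‖ + ‖y n 1‖ := by
    simpa using norm_sub_le (1 + y n 1) (y n 1)
  rw [norm_one] at h6
  linarith

/-! ### Order estimates for the projections -/

theorem star_eq_self {x : LInftySum} (h : ∀ n i, ∃ r : ℝ, x n i = r) : star x = x := by
  refine ext_eval fun n i => ?_
  obtain ⟨r, hr⟩ := h n i
  rw [lp.star_apply, Pi.star_apply, hr, Complex.star_def, Complex.conj_ofReal]

/-- Functions with values in `[0, r]` are self-adjoint and at distance at most `r` from `r • 1`. -/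
theorem isSelfAdjoint_and_norm_le {x : LInftySum} {r : ℝ} (hr : 0 ≤ r)
    (h : ∀ n i, ∃ s : ℝ, 0 ≤ s ∧ s ≤ r ∧ x n i = s) :
    IsSelfAdjoint x ∧ ‖r • (1 : LInftySum) - x‖ ≤ r := by
  refine ⟨star_eq_self fun n i => ?_, norm_le hr fun n i => ?_⟩
  · obtain ⟨s, -, -, hs⟩ := h n i
    exact ⟨s, hs⟩
  · obtain ⟨s, h0, h1, hs⟩ := h n i
    have e : (r • (1 : LInftySum) - x : LInftySum) n i = ((r - s : ℝ) : ℂ) := by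
      rw [lp.coeFn_sub, Pi.sub_apply, Pi.sub_apply, hs, lp.coeFn_smul, Pi.smul_apply,
        Pi.smul_apply, lp.infty_coeFn_one]
      simp
    rw [e, Complex.norm_real, Real.norm_of_nonneg (by linarith)]
    linarith

theorem spike_apply (n m : ℕ) (i : Fin 4) :
    ∃ s : ℝ, 0 ≤ s ∧ s ≤ 1 ∧ spike n m i = s := by
  rcases eq_or_ne m n with rfl | hm
  · rw [spike, lp.single_apply_self]
    fin_cases i
    · exact ⟨1, by simp⟩
    all_goals exact ⟨0, by simp⟩
  · rw [spike, lp.single_apply_ne _ _ _ hm]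
    exact ⟨0, by simp⟩

/-- This supplies the lower half of `-δ ≤ p ≤ δ` modulo the kernel. The upper bound `2` only serves
to express positivity as a norm condition through `isSelfAdjoint_and_norm_le`. -/
theorem weight_add_spike_apply (n m : ℕ) (i : Fin 4) :
    ∃ s : ℝ, 0 ≤ s ∧ s ≤ 2 ∧ (weight n • (1 : LInftySum) + spike n : LInftySum) m i = s := by
  have h0 := weight_pos n
  have h1 := weight_le_one n
  obtain ⟨s, hs0, hs1, hs⟩ := spike_apply n m i
  refine ⟨weight n + s, by linarith, by linarith, ?_⟩
  rw [lp.coeFn_add, Pi.add_apply, Pi.add_apply, hs, lp.coeFn_smul, Pi.smul_apply,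
    Pi.smul_apply, lp.infty_coeFn_one]
  simp

/-- This supplies the upper half, `p ≤ δ + k`. In the `n`-th summand the element is `(δ, 1 + δ, 0,
0)`: adding `δ` exactly cancels the negative entries of `k`. Elsewhere it is constantly `δ`. -/
theorem weight_add_kernelVector_sub_spike_apply (n m : ℕ) (i : Fin 4) :
    ∃ s : ℝ, 0 ≤ s ∧ s ≤ 2 ∧
      (weight n • (1 : LInftySum) + (kernelVector n - spike n) : LInftySum) m i = s := by
  have h0 := weight_pos n
  have h1 := weight_le_one n
  rw [lp.coeFn_add, Pi.add_apply, Pi.add_apply, lp.coeFn_sub, Pi.sub_apply, Pi.sub_apply,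
    lp.coeFn_smul, Pi.smul_apply, Pi.smul_apply, lp.infty_coeFn_one, kernelVector, spike]
  rcases eq_or_ne m n with rfl | hm
  · rw [lp.single_apply_self, lp.single_apply_self]
    fin_cases i
    · exact ⟨weight m, h0.le, by linarith, by simp⟩
    · exact ⟨weight m + 1, by linarith, by linarith, by simp⟩
    all_goals exact ⟨0, le_rfl, by norm_num, by simp⟩
  · rw [lp.single_apply_ne _ _ _ hm, lp.single_apply_ne _ _ _ hm]
    exact ⟨weight n, h0.le, by linarith, by simp⟩

theorem norm_mk_spike_le (n : ℕ) :
    ‖QuotientSystem.mk pairKernel isKernel_pairKernel (spike n)‖ ≤ weight n := by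
  let := CStarAlgebra.spectralOrder LInftySum
  have := CStarAlgebra.spectralOrderedRing LInftySum
  have h0 : (0 : ℝ) ≤ 2 := by norm_num
  have h1 := isSelfAdjoint_and_norm_le h0 (weight_add_spike_apply n)
  have h2 := isSelfAdjoint_and_norm_le h0 (weight_add_kernelVector_sub_spike_apply n)
  have h3 := (QuotientSystem.isUCP_mk (hJ := isKernel_pairKernel)).map_cone 1 _
    (of_mem_cone_one_of_nonneg (nonneg_of_norm_smul_one_sub_le h1.1 h1.2))
  have h4 := (QuotientSystem.isUCP_mk (hJ := isKernel_pairKernel)).map_cone 1 _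
    (of_mem_cone_one_of_nonneg (nonneg_of_norm_smul_one_sub_le h2.1 h2.2))
  -- Since the class of `k` vanishes, positivity of `δ + (k - p)` becomes positivity of `δ - p` in
  -- the quotient.
  have hk : QuotientSystem.mk pairKernel isKernel_pairKernel (kernelVector n) = 0 :=
    QuotientSystem.mk_eq_zero_iff.2 (kernelVector_mem n)
  refine (norm_le_iff (weight_pos n).le).2 (normMatrix_mem_of_abs_le ?_ ?_ ?_)
  · rw [QuotientSystem.star_mk, (isSelfAdjoint_and_norm_le zero_le_one (spike_apply n)).1.star_eq]
  · convert h3 using 1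
    ext i j
    simp only [Matrix.map_apply, Matrix.of_apply, map_add]
    rfl
  · convert h4 using 1
    ext i j
    simp only [Matrix.map_apply, Matrix.of_apply, map_add, map_sub, hk, zero_sub, ← sub_eq_add_neg]
    rfl

/-! ### Transfer to quotients of a C*-algebra -/

theorem map_real_smul_one {B : Type*} [CStarAlgebra B] {ι : LInftySum →ₗ[ℂ] B} (h1 : ι 1 = 1)
    (r : ℝ) : ι (r • (1 : LInftySum)) = r • (1 : B) := by
  have h : r • (1 : LInftySum) = (r : ℂ) • (1 : LInftySum) := rfl
  rw [h, map_smul, h1, Complex.coe_smul]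

/-- Values in `[0, r]` put `x` within `r` of `r • 1`. A unital contraction preserves this norm
condition, and for self-adjoint elements it implies positivity. -/
theorem map_nonneg_of_contractive {B : Type*} [CStarAlgebra B] [PartialOrder B] [StarOrderedRing B]
    {ι : LInftySum →ₗ[ℂ] B} (h1 : ι 1 = 1) (hstar : ∀ x, star (ι x) = ι (star x))
    (hle : ∀ x, ‖ι x‖ ≤ ‖x‖) {x : LInftySum} {r : ℝ} (hr : 0 ≤ r)
    (h : ∀ n i, ∃ s : ℝ, 0 ≤ s ∧ s ≤ r ∧ x n i = s) : 0 ≤ ι x := by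
  obtain ⟨hx, hx'⟩ := isSelfAdjoint_and_norm_le hr h
  refine nonneg_of_norm_smul_one_sub_le (r := r) ?_ ?_
  · rw [IsSelfAdjoint, hstar, hx.star_eq]
  · refine le_trans (le_of_eq ?_) ((hle _).trans hx')
    rw [map_sub, map_real_smul_one h1]

/-- Applying `ι` to `0 ≤ p ≤ δ + k` gives `0 ≤ ι p ≤ δ + ι k` with `ι k` in the ideal, so
`exists_mem_norm_add_le` applies with `d = δ`. -/
theorem norm_quotient_mk_map_spike_le {B : Type*} [CStarAlgebra B] {ι : LInftySum →ₗ[ℂ] B}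
    (h1 : ι 1 = 1) (hstar : ∀ x, star (ι x) = ι (star x)) (hle : ∀ x, ‖ι x‖ ≤ ‖x‖) (n : ℕ) :
    ‖(Submodule.Quotient.mk (ι (spike n)) :
      B ⧸ closedIdeal (ι '' (pairKernel : Set LInftySum)))‖ ≤ 4 * weight n := by
  let := CStarAlgebra.spectralOrder B
  have := CStarAlgebra.spectralOrderedRing B
  have h2 : (0 : ℝ) ≤ 2 := by norm_num
  have h3 := map_nonneg_of_contractive h1 hstar hle h2 (weight_add_kernelVector_sub_spike_apply n)
  rw [map_add, map_sub, map_real_smul_one h1, ← add_sub_assoc, sub_nonneg] at h3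
  obtain ⟨z, hz, hz'⟩ := exists_mem_norm_add_le
    (I := closedIdeal (ι '' (pairKernel : Set LInftySum)))
    (fun x hx c => closedIdeal_mul_mem hx c) (weight_pos n)
    (subset_closedIdeal _ ⟨_, kernelVector_mem n, rfl⟩)
    (map_nonneg_of_contractive h1 hstar hle zero_le_one (spike_apply n)) h3
  refine le_trans (le_of_eq ?_) ((Submodule.Quotient.norm_mk_le
    (closedIdeal (ι '' (pairKernel : Set LInftySum))) (ι (spike n) + z)).trans hz')
  rw [Submodule.Quotient.mk_add, (Submodule.Quotient.mk_eq_zero _).2 hz, add_zero]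

/-! ### Failure of the open mapping estimate -/

/-- A linear map on `ℓ^∞(ℕ, ℓ^∞_4)` with kernel contained in `pairKernel` that is small on the
projections `spike n` does not satisfy the conclusion of the open mapping theorem. -/
theorem not_exists_preimage_norm_le {F : Type*} [SeminormedAddCommGroup F] [Module ℂ F]
    (φ : LInftySum →ₗ[ℂ] F) (hφ : LinearMap.ker φ ≤ pairKernel)
    (h : ∀ n, ‖φ (spike n)‖ ≤ 4 * weight n) :
    ¬ ∃ C > 0, ∀ x, ∃ y, φ y = φ x ∧ ‖y‖ ≤ C * ‖φ x‖ := by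
  rintro ⟨C, hC, hx⟩
  -- This choice makes `4 C / (n + 1) < 1/2`, whereas any preimage of `φ (spike n)` differs from
  -- `spike n` by an element of the kernel and so has norm at least `1/2`.
  obtain ⟨n, hn⟩ := exists_nat_gt (8 * C)
  obtain ⟨y, hy, hy'⟩ := hx (spike n)
  have h1 := half_le_norm_spike_add n (hφ (LinearMap.sub_mem_ker_iff.2 hy))
  rw [add_sub_cancel] at h1
  have h2 : C * ‖φ (spike n)‖ ≤ C * (4 * weight n) := by gcongr; exact h n
  have h3 : C * (4 * weight n) < 1 / 2 := by
    rw [weight, mul_one_div, mul_div, div_lt_div_iff₀ (by positivity) two_pos]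
    linarith
  linarith

/-- The quotient map is a contractive surjection from a Banach space; a complete target would make
it open. -/
theorem not_completeSpace_quotientSystem :
    ¬ CompleteSpace (QuotientSystem pairKernel isKernel_pairKernel) := by
  intro _
  let φ : LInftySum →L[ℂ] QuotientSystem pairKernel isKernel_pairKernel :=
    LinearMap.mkContinuous (QuotientSystem.mk _ _) 1 fun x => by
      rw [one_mul]
      exact norm_mk_le x
  refine not_exists_preimage_norm_le (QuotientSystem.mk pairKernel isKernel_pairKernel)
    (fun x hx => QuotientSystem.mk_eq_zero_iff.1 hx)
    (fun n => (norm_mk_spike_le n).trans (by linarith [weight_pos n])) ?_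
  obtain ⟨C, hC, h⟩ := φ.exists_preimage_norm_le QuotientSystem.mk_surjective
  exact ⟨C, hC, fun x => h _⟩

/-- A closed range would be complete, so the open mapping theorem would apply to the map onto its
range. The hypothesis `hker` places the kernel of the composite inside `pairKernel`. -/
theorem not_isClosed_range_quotient_map {B : Type*} [CStarAlgebra B] {ι : LInftySum →ₗ[ℂ] B}
    (h1 : ι 1 = 1) (hstar : ∀ x, star (ι x) = ι (star x)) (hle : ∀ x, ‖ι x‖ ≤ ‖x‖)
    (hker : ∀ x, ι x ∈ closedIdeal (ι '' (pairKernel : Set LInftySum)) → x ∈ pairKernel) :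
    ¬ IsClosed (Set.range ((closedIdeal (ι '' (pairKernel : Set LInftySum))).mkQ ∘ₗ ι)) := by
  intro hcl
  -- Closedness of the ideal makes the quotient a Banach space rather than a merely seminormed one.
  have := isClosed_closedIdeal (ι '' (pairKernel : Set LInftySum))
  let φ : LInftySum →L[ℂ] B ⧸ closedIdeal (ι '' (pairKernel : Set LInftySum)) :=
    LinearMap.mkContinuous ((closedIdeal (ι '' (pairKernel : Set LInftySum))).mkQ ∘ₗ ι) 1
      fun x => by
        rw [one_mul]
        exact (Submodule.Quotient.norm_mk_le _ _).trans (hle x)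
  have : CompleteSpace φ.range := IsClosed.completeSpace_coe (hs := hcl)
  refine not_exists_preimage_norm_le
    ((closedIdeal (ι '' (pairKernel : Set LInftySum))).mkQ ∘ₗ ι)
    (fun x hx => hker x ((Submodule.Quotient.mk_eq_zero _).1 hx))
    (norm_quotient_mk_map_spike_le h1 hstar hle) ?_
  obtain ⟨C, hC, h⟩ := φ.rangeRestrict.exists_preimage_norm_le
    (LinearMap.surjective_rangeRestrict φ.toLinearMap)
  refine ⟨C, hC, fun x => ?_⟩
  obtain ⟨y, hy, hy'⟩ := h ⟨φ x, x, rfl⟩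
  exact ⟨y, congrArg Subtype.val hy, hy'⟩

/-- The kernel condition holds because the states defining `pairKernel` are unital completely
positive, so each of them still vanishes on every element of the algebra that falls into the ideal.
-/
theorem not_isClosed_range_toUniversalQuotient :
    ¬ IsClosed (Set.range (toUniversalQuotient pairKernel)) := by
  refine not_isClosed_range_quotient_map toUniversalCStar_one star_toUniversalCStar
    norm_toUniversalCStar_le fun x hx => ?_
  simp only [pairKernel, Submodule.mem_iInf, LinearMap.mem_ker]
  intro f hf
  refine apply_eq_zero_of_mem_closedIdeal hx (isUCP_of_mem_pairStates hf) fun y hy => ?_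
  simp only [pairKernel, Submodule.mem_iInf, LinearMap.mem_ker] at hy
  exact hy f hf

theorem half_le_norm_quotient_mk_spike (n : ℕ) :
    1 / 2 ≤ ‖(Submodule.Quotient.mk (spike n) : LInftySum ⧸ pairKernel)‖ := by
  refine le_of_forall_pos_le_add fun ε hε => ?_
  obtain ⟨y, hy, hy'⟩ := Submodule.Quotient.norm_mk_lt
    (Submodule.Quotient.mk (spike n) : LInftySum ⧸ pairKernel) hε
  have h1 := half_le_norm_spike_add n ((Submodule.Quotient.eq _).1 hy)
  rw [add_sub_cancel] at h1
  exact h1.trans hy'.le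

end LInftySum

end

open LInftySum in
theorem mainTheorem11 :
    ∃ (J : Submodule ℂ LInftySum) (hJ : OperatorSystem.IsKernel J),
      ¬ CompleteSpace (OperatorSystem.QuotientSystem J hJ) ∧
      (¬ ∃ c C : ℝ, 0 < c ∧ 0 < C ∧ ∀ x : LInftySum,
        c * ‖(Submodule.Quotient.mk x : LInftySum ⧸ J)‖ ≤ ‖OperatorSystem.QuotientSystem.mk J hJ x‖ ∧
        ‖OperatorSystem.QuotientSystem.mk J hJ x‖ ≤ C * ‖(Submodule.Quotient.mk x : LInftySum ⧸ J)‖) ∧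
      ¬ IsClosed (Set.range (OperatorSystem.toUniversalQuotient J)) := by
  refine ⟨pairKernel, isKernel_pairKernel, not_completeSpace_quotientSystem, ?_,
    not_isClosed_range_toUniversalQuotient⟩
  rintro ⟨c, C, hc, -, h⟩
  -- Equivalence would give `c / 2 ≤ 1 / (n + 1)`, that is `n + 1 ≤ 2 / c`.
  obtain ⟨n, hn⟩ := exists_nat_gt (2 / c)
  have h1 := mul_le_mul_of_nonneg_left (half_le_norm_quotient_mk_spike n) hc.le
  have h2 := h1.trans ((h (spike n)).1.trans (norm_mk_spike_le n))
  rw [weight, mul_one_div, div_le_div_iff₀ two_pos (by positivity)] at h2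
  rw [div_lt_iff₀ hc] at hn
  linarith
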